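/- Let $a\ge 2$ be an integer, and let $z\neq 0$ and $q$ be complex numbers with $|q|<1$. Put $$E(q)=\prod_{n\ge 1}(1-q^n)$$ and $$C_a(z;q)=\sum_{\substack{n=(n_0,\dots,n_{a-1})\in\mathbb Z^a\\ n_0+\cdots+n_{a-1}=0}} q^{\frac a2\sum_{i=0}^{a-1}n_i^2+\sum_{i=0}^{a-1} i\,n_i}\left(z^{an_1+1}+z^{an_2+2}+\cdots+z^{an_{a-1}+a-1}+z^{-an_{a-1}}\right).$$ Then the series converges absolutely, the infinite products converge, and $$C_a(z;q)=E(q)\,E(q^a)^{a-2}\prod_{n=1}^{\infty}\frac{(1-z^aq^{a(n-1)})(1-z^{-a}q^{an})}{(1-zq^{n-1})(1-z^{-1}q^{n})}$$ whenever no denominator on the right vanishes. At every $z_0\ne 0$, including the points $z_0$ at which a denominator vanishes, the right-hand side has a limit as $z\to z_0$, $z\neq z_0$, and this limit is $C_a(z_0;q)$; in other words, the identity holds for all $z\neq0$ once the removable singularities of the right-hand side are removed. -/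

import Mathlib

open Filter Topology

noncomputable section

namespace ThetaIdentity

/-- The infinite product `E(q) = ∏_{n ≥ 1} (1 - q ^ n)`. -/
def E (q : ℂ) : ℂ := ∏' n : ℕ, (1 - q ^ (n + 1))

/-- The vectors `n = (n_0, …, n_{a-1}) ∈ ℤ^a` whose coordinates sum to `0`. -/
abbrev ZeroSum (a : ℕ) : Type := {n : Fin a → ℤ // ∑ i, n i = 0}

/-- The exponent `(a / 2) (n · n) + b_a · n`, where `b_a = (0, 1, …, a - 1)`. On vectors with
coordinate sum `0` the number `n · n` is even, so the integer division is exact: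
see `quadForm_cast`. -/
def quadForm (a : ℕ) (n : ZeroSum a) : ℤ :=
  (a : ℤ) * (∑ i, n.1 i ^ 2) / 2 + ∑ i : Fin a, ((i : ℕ) : ℤ) * n.1 i

theorem quadForm_cast (a : ℕ) (n : ZeroSum a) :
    (quadForm a n : ℚ) =
      (a : ℚ) / 2 * (∑ i, (n.1 i : ℚ) ^ 2) + ∑ i : Fin a, ((i : ℕ) : ℚ) * (n.1 i : ℚ) := by
  have h : (2 : ℤ) ∣ ∑ i, n.1 i ^ 2 := by
    have h1 : (2 : ℤ) ∣ ∑ i, (n.1 i ^ 2 - n.1 i) := by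
      refine Finset.dvd_sum fun i _ => ?_
      have h2 := (Int.even_mul_pred_self (n.1 i)).two_dvd
      have h3 : n.1 i ^ 2 - n.1 i = n.1 i * (n.1 i - 1) := by ring
      rwa [h3]
    rwa [Finset.sum_sub_distrib, n.2, sub_zero] at h1
  obtain ⟨k, hk⟩ := h
  have hk' : (∑ i, (n.1 i : ℚ) ^ 2) = 2 * k := by exact_mod_cast hk
  have h4 : (a : ℤ) * (2 * k) / 2 = a * k := by
    rw [show (a : ℤ) * (2 * k) = a * k * 2 by ring]
    exact Int.mul_ediv_cancel _ two_ne_zero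
  unfold quadForm
  rw [hk, hk', h4]
  push_cast
  ring

/-- `z^{a n_1 + 1} + z^{a n_2 + 2} + ⋯ + z^{a n_{a-1} + a - 1} + z^{-a n_{a-1}}`. -/
def zFactor (a : ℕ) (ha : 2 ≤ a) (z : ℂ) (n : ZeroSum a) : ℂ :=
  (∑ j ∈ Finset.univ.filter (fun j : Fin a => 1 ≤ (j : ℕ)), z ^ ((a : ℤ) * n.1 j + ((j : ℕ) : ℤ))) +
    z ^ (-((a : ℤ) * n.1 ⟨a - 1, by omega⟩))

/-- The summand of `C_a(z; q)` at the vector `n`. -/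
def cTerm (a : ℕ) (ha : 2 ≤ a) (z q : ℂ) (n : ZeroSum a) : ℂ :=
  q ^ quadForm a n * zFactor a ha z n

/-- The multidimensional theta function `C_a(z; q)`. -/
def C (a : ℕ) (ha : 2 ≤ a) (z q : ℂ) : ℂ := ∑' n : ZeroSum a, cTerm a ha z q n

/-- The factor with index `n + 1` of the infinite product,
`(1 - z^a q^{a n}) (1 - z^{-a} q^{a (n + 1)}) / ((1 - z q^n) (1 - z^{-1} q^{n + 1}))`. -/
def rFactor (a : ℕ) (z q : ℂ) (n : ℕ) : ℂ :=
  ((1 - z ^ a * q ^ (a * n)) * (1 - (z ^ a)⁻¹ * q ^ (a * (n + 1)))) /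
    ((1 - z * q ^ n) * (1 - z⁻¹ * q ^ (n + 1)))

/-- `E(q) E(q^a)^{a-2}` times the infinite product of the factors `rFactor`. -/
def R (a : ℕ) (z q : ℂ) : ℂ := E q * E (q ^ a) ^ (a - 2) * ∏' n : ℕ, rFactor a z q n

end ThetaIdentity

end

/-! Regard `C` as a sum over zero-sum vectors with a marked coordinate `j`, with terms `q ^ weight n
* z ^ (a * n_j + j)`; the exceptional term `z^{-a n_{a-1}}` is the case `j = 0` after `n_i ↦
-n_{a-1-i}` (`C_eq_tsum_marked`). Multiply by Jacobi's series `∑ (-1)^l q^{l(l-1)/2} z^l`. A cyclic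
shift of `ℤ^a` moves every `a * N_i + i` by one, so the pairs (marked zero-sum vector, `l`)
correspond to all marked vectors, and the exponents match (`zeroSumShiftEquiv_spec`).

The unrestricted sum splits into products of one-dimensional theta series (`tsum_marked`). For `j ≠
0` the factor at `i = 0` is a multiple of `theta 1 (q^a) = 0`, so only `j = 0` survives. The triple
product (`tsum_thetaTerm`) and `prod_theta_pow` then give `C_mul_theta`, the identity without
denominators.

Dividing by `theta z q` gives the product formula. Zeros of `theta` are isolated away from `0` and
`C` is continuous there, which gives the limit. -/

noncomputable section

namespace ThetaIdentity

/-! ### Infinite products. -/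

/-- The infinite `q`-Pochhammer symbol `(x; q)_∞`. -/
def poch (x q : ℂ) : ℂ := ∏' n : ℕ, (1 - x * q ^ n)

/-- The modified theta function `(z; q)_∞ (q / z; q)_∞`. -/
def theta (z q : ℂ) : ℂ := poch z q * poch (z⁻¹ * q) q

theorem summable_norm_mul_pow (x : ℂ) {q : ℂ} (hq : ‖q‖ < 1) :
    Summable (fun n : ℕ => ‖-(x * q ^ n)‖) := by
  simp only [norm_neg, norm_mul, norm_pow]
  exact (summable_geometric_of_lt_one (norm_nonneg q) hq).mul_left _

theorem multipliable_poch (x : ℂ) {q : ℂ} (hq : ‖q‖ < 1) :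
    Multipliable (fun n : ℕ => 1 - x * q ^ n) := by
  simpa only [sub_eq_add_neg] using multipliable_one_add_of_summable (summable_norm_mul_pow x hq)

theorem hasProd_poch (x : ℂ) {q : ℂ} (hq : ‖q‖ < 1) :
    HasProd (fun n : ℕ => 1 - x * q ^ n) (poch x q) :=
  (multipliable_poch x hq).hasProd

theorem poch_ne_zero {x q : ℂ} (hq : ‖q‖ < 1) (h : ∀ n : ℕ, 1 - x * q ^ n ≠ 0) :
    poch x q ≠ 0 := by
  simp only [sub_eq_add_neg] at h
  have := tprod_one_add_ne_zero_of_summable h (summable_norm_mul_pow x hq)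
  simpa only [poch, sub_eq_add_neg] using this

theorem poch_ne_zero_of_norm_lt_one {x q : ℂ} (hq : ‖q‖ < 1) (hx : ‖x‖ < 1) : poch x q ≠ 0 := by
  refine poch_ne_zero hq fun n h => ?_
  have h1 : x * q ^ n = 1 := (sub_eq_zero.mp h).symm
  have h2 : ‖x‖ * ‖q‖ ^ n = 1 := by rw [← norm_pow, ← norm_mul, h1, norm_one]
  have h3 : ‖q‖ ^ n ≤ 1 := pow_le_one₀ (norm_nonneg _) hq.le
  nlinarith [norm_nonneg x]

theorem E_eq_poch (q : ℂ) : E q = poch q q := by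
  simp only [E, poch, pow_succ']

/-! ### Finite form of the triple product. -/

/-- The triangular number `j (j - 1) / 2`. -/
def tri (j : ℤ) : ℤ := j * (j - 1) / 2

theorem two_mul_tri (j : ℤ) : 2 * tri j = j * (j - 1) :=
  Int.mul_ediv_cancel' (Int.even_mul_pred_self j).two_dvd

theorem tri_nonneg (j : ℤ) : 0 ≤ tri j := by
  have h := two_mul_tri j
  rcases le_or_gt j 0 with h0 | h0 <;> nlinarith

theorem tri_add_one (j : ℤ) : tri (j + 1) = tri j + j := by
  have h1 := two_mul_tri j
  have h2 := two_mul_tri (j + 1)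
  linarith

/-- The terms of Jacobi's theta series. -/
def thetaTerm (q z : ℂ) (j : ℤ) : ℂ := (-1) ^ j * q ^ tri j * z ^ j

theorem thetaTerm_add_one {q z : ℂ} (hq : q ≠ 0) (hz : z ≠ 0) (j : ℤ) :
    thetaTerm q z (j + 1) = -(z * q ^ j) * thetaTerm q z j := by
  unfold thetaTerm
  rw [tri_add_one, zpow_add₀ (by norm_num : (-1 : ℂ) ≠ 0), zpow_add₀ hq, zpow_add₀ hz]
  simp only [zpow_one]
  ring

/-- The finite `q`-Pochhammer symbol `(q; q)_n`. -/
def qFac (q : ℂ) (n : ℕ) : ℂ := ∏ k ∈ Finset.range n, (1 - q * q ^ k)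

theorem one_sub_pow_succ_ne_zero {q : ℂ} (hq : ‖q‖ < 1) (k : ℕ) : 1 - q * q ^ k ≠ 0 := by
  intro h
  have h1 : q ^ (k + 1) = 1 := by rw [pow_succ']; exact (sub_eq_zero.mp h).symm
  have h2 : ‖q‖ ^ (k + 1) = 1 := by rw [← norm_pow, h1, norm_one]
  exact absurd h2 (pow_lt_one₀ (norm_nonneg _) hq (Nat.succ_ne_zero k)).ne

theorem qFac_ne_zero {q : ℂ} (hq : ‖q‖ < 1) (n : ℕ) : qFac q n ≠ 0 :=
  Finset.prod_ne_zero_iff.mpr fun k _ => one_sub_pow_succ_ne_zero hq k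

theorem tendsto_qFac {q : ℂ} (hq : ‖q‖ < 1) : Tendsto (qFac q) atTop (𝓝 (poch q q)) :=
  (hasProd_poch q hq).tendsto_prod_nat

/-- `1 / (q; q)_n`, extended by zero to negative `n`. -/
def invFac (q : ℂ) (n : ℤ) : ℂ := if 0 ≤ n then (qFac q n.toNat)⁻¹ else 0

theorem invFac_of_neg (q : ℂ) {n : ℤ} (h : n < 0) : invFac q n = 0 := by
  simp [invFac, h]

theorem invFac_natCast (q : ℂ) (n : ℕ) : invFac q n = (qFac q n)⁻¹ := by
  simp [invFac]

/-- Extension by zero makes the recurrence hold on all of `ℤ`: at `n = 0` the factor `1 - q ^ n`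
vanishes. -/
theorem invFac_sub_one {q : ℂ} (hq : ‖q‖ < 1) (n : ℤ) :
    invFac q (n - 1) = (1 - q ^ n) * invFac q n := by
  rcases lt_trichotomy n 0 with h | h | h
  · rw [invFac_of_neg q h, invFac_of_neg q (by omega), mul_zero]
  · subst h
    rw [invFac_of_neg q (by omega)]
    simp
  · obtain ⟨m, rfl⟩ : ∃ m : ℕ, n = ((m + 1 : ℕ) : ℤ) := ⟨(n - 1).toNat, by omega⟩
    rw [show ((m + 1 : ℕ) : ℤ) - 1 = (m : ℤ) by push_cast; ring, invFac_natCast, invFac_natCast,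
      zpow_natCast, pow_succ']
    have h1 := one_sub_pow_succ_ne_zero hq m
    have h2 := qFac_ne_zero hq m
    have h3 : qFac q (m + 1) = qFac q m * (1 - q * q ^ m) := Finset.prod_range_succ _ _
    rw [h3]
    field_simp

theorem exists_norm_bound_qFac {q : ℂ} (hq : ‖q‖ < 1) :
    ∃ C : ℝ, 0 ≤ C ∧ (∀ n, ‖qFac q n‖ ≤ C) ∧ ∀ n, ‖invFac q n‖ ≤ C := by
  have h0 : poch q q ≠ 0 := poch_ne_zero_of_norm_lt_one hq hq
  obtain ⟨A, hA⟩ := (tendsto_qFac hq).norm.bddAbove_range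
  obtain ⟨B, hB⟩ := ((tendsto_qFac hq).inv₀ h0).norm.bddAbove_range
  have hA' : ∀ n, ‖qFac q n‖ ≤ A := fun n => hA ⟨n, rfl⟩
  have hB' : ∀ n, ‖(qFac q n)⁻¹‖ ≤ B := fun n => hB ⟨n, rfl⟩
  have hA0 : 0 ≤ A := (norm_nonneg _).trans (hA' 0)
  refine ⟨max A B, le_max_of_le_left hA0, fun n => (hA' n).trans (le_max_left _ _), fun n => ?_⟩
  unfold invFac
  split_ifs
  · exact (hB' _).trans (le_max_right _ _)
  · simpa using Or.inl hA0

theorem tendsto_invFac_atTop {q : ℂ} (hq : ‖q‖ < 1) :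
    Tendsto (invFac q) atTop (𝓝 (poch q q)⁻¹) := by
  have h0 : poch q q ≠ 0 := poch_ne_zero_of_norm_lt_one hq hq
  have h1 : Tendsto (fun n : ℤ => (qFac q n.toNat)⁻¹) atTop (𝓝 (poch q q)⁻¹) :=
    ((tendsto_qFac hq).inv₀ h0).comp
      (tendsto_atTop_atTop.mpr fun b => ⟨b, fun n hn => by omega⟩)
  refine h1.congr' ?_
  filter_upwards [eventually_ge_atTop 0] with n hn
  simp [invFac, hn]

/-- The finite form of Jacobi's triple product identity. -/
theorem hasSum_finite_triple_product {q z : ℂ} (hq : ‖q‖ < 1) (hq0 : q ≠ 0) (hz : z ≠ 0) (N : ℕ) :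
    HasSum (fun j : ℤ => qFac q (2 * N) * (invFac q (N + j) * invFac q (N - j)) * thetaTerm q z j)
      (∏ n ∈ Finset.range N, ((1 - z * q ^ n) * (1 - z⁻¹ * q * q ^ n))) := by
  induction N with
  | zero =>
    have h : ∀ j : ℤ, j ≠ 0 → qFac q (2 * 0) * (invFac q ((0 : ℕ) + j) * invFac q ((0 : ℕ) - j)) *
        thetaTerm q z j = 0 := by
      intro j hj
      rcases lt_or_gt_of_ne hj with h | h
      · rw [invFac_of_neg q (n := (0 : ℕ) + j) (by simpa using h)]; simp
      · rw [invFac_of_neg q (n := (0 : ℕ) - j) (by simpa using h)]; simp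
    have h1 := hasSum_single (0 : ℤ) h
    simpa [qFac, invFac, thetaTerm, tri] using h1
  | succ N ih =>
    -- The new factor expands to `1 + q^(2N+1) - z q^N - z⁻¹ q^(N+1)`; multiplication by `z` or
    -- `z⁻¹` shifts the summation index.
    have hm := (Equiv.subRight (1 : ℤ)).hasSum_iff.mpr ih
    have hp := (Equiv.addRight (1 : ℤ)).hasSum_iff.mpr ih
    have key := ((ih.mul_left (1 + q ^ (2 * N + 1))).add (hm.mul_left (-(z * q ^ N)))).add
      (hp.mul_left (-(z⁻¹ * q * q ^ N)))
    rw [Finset.prod_range_succ]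
    convert key using 1
    · rfl
    · funext j
      simp only [Function.comp_apply, Equiv.subRight_apply, Equiv.coe_addRight]
      set A := invFac q (N + 1 + j) with hA
      set B := invFac q (N + 1 - j) with hB
      have a1 : invFac q (N + j) = (1 - q ^ ((N : ℤ) + 1 + j)) * A := by
        rw [hA, ← invFac_sub_one hq]; congr 1; ring
      have b1 : invFac q (N - j) = (1 - q ^ ((N : ℤ) + 1 - j)) * B := by
        rw [hB, ← invFac_sub_one hq]; congr 1; ring
      have a2 : invFac q (N + (j - 1)) = (1 - q ^ ((N : ℤ) + j)) * invFac q (N + j) := by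
        rw [← invFac_sub_one hq]; congr 1; ring
      have b2 : invFac q (N - (j + 1)) = (1 - q ^ ((N : ℤ) - j)) * invFac q (N - j) := by
        rw [← invFac_sub_one hq]; congr 1; ring
      have a3 : invFac q (N + (j + 1)) = A := by rw [hA]; congr 1; ring
      have b3 : invFac q (N - (j - 1)) = B := by rw [hB]; congr 1; ring
      have a4 : invFac q ((N + 1 : ℕ) + j) = A := by rw [hA]; push_cast; rfl
      have b4 : invFac q ((N + 1 : ℕ) - j) = B := by rw [hB]; push_cast; rfl
      have f : qFac q (2 * (N + 1)) =
          qFac q (2 * N) * (1 - q * q ^ (2 * N)) * (1 - q * q ^ (2 * N + 1)) := by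
        rw [show 2 * (N + 1) = 2 * N + 1 + 1 by ring]
        unfold qFac
        rw [Finset.prod_range_succ, Finset.prod_range_succ]
      have t1 : thetaTerm q z (j + 1) = -(z * q ^ j) * thetaTerm q z j :=
        thetaTerm_add_one hq0 hz j
      have t2 : thetaTerm q z (j - 1) = -(z⁻¹ * q * (q ^ j)⁻¹) * thetaTerm q z j := by
        have h := thetaTerm_add_one hq0 hz (j - 1)
        rw [sub_add_cancel] at h
        rw [h, zpow_sub_one₀ hq0]
        field_simp
      rw [a4, b4, a2, b2, a3, b3, a1, b1, f, t1, t2]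
      have hj := zpow_ne_zero j hq0
      simp only [zpow_add₀ hq0, zpow_sub₀ hq0, zpow_natCast, zpow_one]
      generalize thetaTerm q z j = t
      generalize q ^ j = u at hj
      rw [show q ^ (2 * N + 1) = (q ^ N) ^ 2 * q by ring, show q ^ (2 * N) = (q ^ N) ^ 2 by ring]
      generalize q ^ N = v
      field_simp
      ring
    · have h : z * z⁻¹ = 1 := mul_inv_cancel₀ hz
      generalize ∏ x ∈ Finset.range N, ((1 - z * q ^ x) * (1 - z⁻¹ * q * q ^ x)) = p
      linear_combination p * q ^ (2 * N + 1) * h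

/-! ### Gaussian bounds and Jacobi's triple product. -/

theorem norm_zpow_le_pow_natAbs {z : ℂ} {Z : ℝ} (h : ‖z‖ ≤ Z) (h' : ‖z⁻¹‖ ≤ Z) (n : ℤ) :
    ‖z ^ n‖ ≤ Z ^ n.natAbs := by
  obtain ⟨m, rfl | rfl⟩ := n.eq_nat_or_neg
  · rw [zpow_natCast, norm_pow, Int.natAbs_natCast]
    gcongr
  · rw [zpow_neg, zpow_natCast, ← inv_pow, norm_pow, Int.natAbs_neg, Int.natAbs_natCast]
    gcongr

theorem zpow_le_pow_of_le_one {r : ℝ} (h0 : 0 ≤ r) (h1 : r ≤ 1) {k : ℕ} {e : ℤ}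
    (h : (k : ℤ) ≤ e) : r ^ e ≤ r ^ k := by
  lift e to ℕ using (by omega)
  rw [zpow_natCast]
  exact pow_le_pow_of_le_one h0 h1 (by exact_mod_cast h)

theorem natAbs_triangle_le {n e : ℤ} (h : |n| * (|n| - 1) ≤ 2 * e) :
    ((n.natAbs * (n.natAbs - 1) / 2 : ℕ) : ℤ) ≤ e := by
  rw [Int.abs_eq_natAbs] at h
  generalize n.natAbs = k at *
  have h1 : ((k * (k - 1) : ℕ) : ℤ) ≤ 2 * e := by
    cases k with
    | zero => simpa using h
    | succ m => push_cast at h ⊢; simpa using h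
  omega

/-- The Gaussian bound for theta series converges. -/
theorem summable_gaussian {r Z : ℝ} (h0 : 0 ≤ r) (h1 : r < 1) (hZ : 0 ≤ Z) :
    Summable (fun n : ℤ => r ^ (n.natAbs * (n.natAbs - 1) / 2) * Z ^ n.natAbs) := by
  have key : Summable (fun n : ℕ => r ^ (n * (n - 1) / 2) * Z ^ n) := by
    have hlim : Tendsto (fun n : ℕ => r ^ n * Z) atTop (𝓝 (0 * Z)) :=
      (tendsto_pow_atTop_nhds_zero_of_lt_one h0 h1).mul_const Z
    rw [zero_mul] at hlim
    have hev := hlim.eventually (gt_mem_nhds (show (0 : ℝ) < 1 / 2 by norm_num))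
    obtain ⟨K, hK⟩ := eventually_atTop.mp hev
    refine Summable.of_norm_bounded_eventually_nat (g := fun n => (1 / 2 : ℝ) ^ n)
      (summable_geometric_of_lt_one (by norm_num) (by norm_num)) ?_
    filter_upwards [eventually_ge_atTop (2 * K + 2)] with n hn
    rw [Real.norm_of_nonneg (by positivity)]
    -- From here on the term is at most `(r ^ K * Z) ^ n`, and `K` was chosen so that `r ^ K * Z < 1
    -- / 2`.
    have h2 : K * n ≤ n * (n - 1) / 2 := by
      rw [Nat.le_div_iff_mul_le two_pos]
      obtain ⟨m, rfl⟩ : ∃ m, n = m + 1 := ⟨n - 1, by omega⟩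
      simp only [Nat.add_sub_cancel]
      nlinarith
    calc r ^ (n * (n - 1) / 2) * Z ^ n ≤ r ^ (K * n) * Z ^ n := by
          gcongr ?_ * _
          exact pow_le_pow_of_le_one h0 h1.le h2
      _ = (r ^ K * Z) ^ n := by rw [mul_pow, pow_mul]
      _ ≤ (1 / 2) ^ n := by
          gcongr
          exact (hK K le_rfl).le
  exact Summable.of_nat_of_neg (by simpa using key) (by simpa using key)

theorem two_mul_tri_ge (n : ℤ) : |n| * (|n| - 1) ≤ 2 * tri n := by
  rw [two_mul_tri]
  have h1 : |n| * |n| = n * n := abs_mul_abs_self n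
  have h2 := le_abs_self n
  nlinarith

theorem summable_norm_thetaTerm {q : ℂ} (hq : ‖q‖ < 1) (z : ℂ) :
    Summable (fun j => ‖thetaTerm q z j‖) := by
  have h : 0 ≤ max ‖z‖ ‖z⁻¹‖ := le_max_of_le_left (norm_nonneg _)
  refine Summable.of_nonneg_of_le (fun _ => norm_nonneg _) (fun j => ?_)
    (summable_gaussian (norm_nonneg q) hq h)
  unfold thetaTerm
  rw [norm_mul, norm_mul, norm_zpow, norm_neg, norm_one, one_zpow, one_mul, norm_zpow]
  exact mul_le_mul
    (zpow_le_pow_of_le_one (norm_nonneg _) hq.le (natAbs_triangle_le (two_mul_tri_ge j)))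
    (norm_zpow_le_pow_natAbs (le_max_left _ _) (le_max_right _ _) j) (norm_nonneg _) (by positivity)

/-- Jacobi's triple product identity. -/
theorem tsum_thetaTerm {q z : ℂ} (hq : ‖q‖ < 1) (hq0 : q ≠ 0) (hz : z ≠ 0) :
    ∑' j, thetaTerm q z j = E q * theta z q := by
  have h0 : poch q q ≠ 0 := poch_ne_zero_of_norm_lt_one hq hq
  obtain ⟨C, hC0, hC1, hC2⟩ := exists_norm_bound_qFac hq
  -- Each coefficient tends to `(q;q)_∞ / (q;q)_∞² = 1 / (q;q)_∞` and is bounded independently of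
  -- `N` and `j`.
  have lim1 : Tendsto (fun N : ℕ => ∑' j : ℤ,
      qFac q (2 * N) * (invFac q (N + j) * invFac q (N - j)) * thetaTerm q z j) atTop
      (𝓝 (∑' j : ℤ, (poch q q)⁻¹ * thetaTerm q z j)) := by
    refine tendsto_tsum_of_dominated_convergence (bound := fun j => C * (C * C) * ‖thetaTerm q z j‖)
      ((summable_norm_thetaTerm hq z).mul_left _) (fun j => ?_) (Eventually.of_forall fun N j => ?_)
    · refine Tendsto.mul_const _ ?_
      have l1 : Tendsto (fun N : ℕ => qFac q (2 * N)) atTop (𝓝 (poch q q)) :=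
        (tendsto_qFac hq).comp (tendsto_atTop_atTop.mpr fun b => ⟨b, fun n hn => by omega⟩)
      have l2 : Tendsto (fun N : ℕ => invFac q (N + j)) atTop (𝓝 (poch q q)⁻¹) :=
        (tendsto_invFac_atTop hq).comp
          (tendsto_atTop_atTop.mpr fun b => ⟨(b - j).toNat, fun n hn => by omega⟩)
      have l3 : Tendsto (fun N : ℕ => invFac q (N - j)) atTop (𝓝 (poch q q)⁻¹) :=
        (tendsto_invFac_atTop hq).comp
          (tendsto_atTop_atTop.mpr fun b => ⟨(b + j).toNat, fun n hn => by omega⟩)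
      have := l1.mul (l2.mul l3)
      rwa [mul_inv_cancel_left₀ h0] at this
    · rw [norm_mul, norm_mul, norm_mul]
      gcongr <;> apply_assumption
  have lim2 : Tendsto (fun N : ℕ => ∏ n ∈ Finset.range N,
      ((1 - z * q ^ n) * (1 - z⁻¹ * q * q ^ n))) atTop (𝓝 (theta z q)) :=
    ((hasProd_poch z hq).mul (hasProd_poch (z⁻¹ * q) hq)).tendsto_prod_nat
  have h := tendsto_nhds_unique lim1
    (lim2.congr fun N => (hasSum_finite_triple_product hq hq0 hz N).tsum_eq.symm)
  rw [tsum_mul_left] at h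
  rw [E_eq_poch, ← h, mul_inv_cancel_left₀ h0]

/-- Induction splits off one coordinate; norm summability is carried along because the product of
two series needs it. -/
theorem summable_norm_and_tsum_pi_prod {R κ : Type*} [NormedField R] [CompleteSpace R] (n : ℕ)
    (f : Fin n → κ → R) (hf : ∀ i, Summable fun k => ‖f i k‖) :
    (Summable fun N : Fin n → κ => ‖∏ i, f i (N i)‖) ∧
      ∑' N : Fin n → κ, ∏ i, f i (N i) = ∏ i, ∑' k, f i k := by
  induction n with
  | zero => exact ⟨(hasSum_fintype _).summable, by simp⟩
  | succ n ih =>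
    obtain ⟨ih1, ih2⟩ := ih (fun i => f i.succ) fun i => hf i.succ
    let e : κ × (Fin n → κ) ≃ (Fin (n + 1) → κ) := Fin.consEquiv fun _ => κ
    have he : ∀ x, ∏ i, f i (e x i) = f 0 x.1 * ∏ i : Fin n, f i.succ (x.2 i) := fun x => by
      rw [Fin.prod_univ_succ]; rfl
    constructor
    · rw [← e.summable_iff]
      simpa only [Function.comp_def, he] using (hf 0).mul_norm ih1
    · rw [← e.tsum_eq]
      simp only [he]
      rw [← tsum_mul_tsum_of_summable_norm (hf 0) ih1, ih2, Fin.prod_univ_succ]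

/-! ### The cyclic shift on marked vectors. -/

section Shift

variable {a : ℕ} [NeZero a]

theorem fin_val_add_one (i : Fin a) :
    ((i + 1 : Fin a).val : ℤ) = i.val + 1 - a * if i + 1 = 0 then 1 else 0 := by
  obtain ⟨n, rfl⟩ : ∃ n, a = n + 1 := ⟨a - 1, by have := NeZero.pos a; omega⟩
  rw [Fin.val_add_one]
  by_cases h : i = Fin.last n
  · subst h; simp
  · have h1 : i + 1 ≠ 0 := by
      intro h2
      have := congrArg Fin.val h2
      rw [Fin.val_add_one, if_neg h] at this
      simp at this
    rw [if_neg h, if_neg h1]; push_cast; ring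

/-- Cyclic shift of `ℤ^a` which lowers every `a * N i + i` by one. -/
def shift (a : ℕ) [NeZero a] : Equiv.Perm (Fin a → ℤ) where
  toFun N i := N (i + 1) - if i + 1 = 0 then 1 else 0
  invFun N i := N (i - 1) + if i = 0 then 1 else 0
  left_inv N := by funext i; simp
  right_inv N := by funext i; simp

/-- The shift of a vector together with a marked coordinate. -/
def markedShift (a : ℕ) [NeZero a] : Equiv.Perm ((Fin a → ℤ) × Fin a) :=
  (shift a).prodCongr (Equiv.subRight 1)

/-- The exponent of `q` attached to a vector. -/
def weight (N : Fin a → ℤ) : ℤ := ∑ i, ((a : ℤ) * tri (N i) + (i.val : ℤ) * N i)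

/-- The number `a * N j + j` at the marked coordinate `j`. -/
def markedValue (x : (Fin a → ℤ) × Fin a) : ℤ := a * x.1 x.2 + (x.2.val : ℤ)

theorem sum_comp_add_one (g : Fin a → ℤ) : ∑ i, g (i + 1) = ∑ i, g i :=
  Fintype.sum_equiv (Equiv.addRight 1) _ _ fun _ => rfl

theorem sum_ite_add_one_eq_zero : ∑ i : Fin a, (if i + 1 = 0 then (1 : ℤ) else 0) = 1 := by
  rw [sum_comp_add_one (fun i => if i = 0 then (1 : ℤ) else 0)]
  simp

theorem sum_shift (N : Fin a → ℤ) : ∑ i, shift a N i = ∑ i, N i - 1 := by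
  simp only [shift, Equiv.coe_fn_mk, Finset.sum_sub_distrib, sum_ite_add_one_eq_zero]
  rw [sum_comp_add_one N]

/-- With `m_i = a N_i + i`, the weight is `∑ (m_i² - i²) / (2a) - (a/2) ∑ N_i`, and the shift
replaces the family `m_i` by `m_i - 1` up to order. -/
theorem weight_shift (N : Fin a → ℤ) : weight (shift a N) = weight N + 1 - ∑ i, N i := by
  have h : ∀ i : Fin a, (a : ℤ) * tri (shift a N i) + (i.val : ℤ) * shift a N i =
      ((a : ℤ) * tri (N (i + 1)) + ((i + 1 : Fin a).val : ℤ) * N (i + 1)) +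
        (if i + 1 = 0 then (1 : ℤ) else 0) - N (i + 1) := by
    intro i
    have h1 := two_mul_tri (shift a N i)
    have h2 := two_mul_tri (N (i + 1))
    have h3 := fin_val_add_one i
    rw [← mul_right_inj' (two_ne_zero (α := ℤ))]
    simp only [shift, Equiv.coe_fn_mk] at h1 ⊢
    split_ifs at h1 h3 ⊢ with hi
    · rw [hi] at h2 h1 h3 ⊢
      simp only [Fin.val_zero, Nat.cast_zero] at h3 ⊢
      linear_combination (a : ℤ) * h1 - (a : ℤ) * h2 - 2 * (N 0 - 1) * h3
    · rw [sub_zero] at h1 ⊢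
      linear_combination -2 * N (i + 1) * h3
  unfold weight
  rw [Finset.sum_congr rfl fun i _ => h i, Finset.sum_sub_distrib, Finset.sum_add_distrib,
    sum_ite_add_one_eq_zero, sum_comp_add_one N,
    sum_comp_add_one fun i => (a : ℤ) * tri (N i) + (i.val : ℤ) * N i]

theorem markedValue_markedShift (x : (Fin a → ℤ) × Fin a) :
    markedValue (markedShift a x) = markedValue x - 1 := by
  obtain ⟨N, j⟩ := x
  have h := fin_val_add_one (j - 1)
  simp only [sub_add_cancel] at h
  simp only [markedValue, markedShift, shift, Equiv.prodCongr_apply, Prod.map_apply,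
    Equiv.coe_fn_mk, Equiv.subRight_apply, sub_add_cancel]
  rw [mul_sub]
  linarith

/-- Each shift adds one minus the current coordinate sum, which itself drops by one; these
increments accumulate to the triangular number. -/
theorem markedShift_zpow (l : ℤ) (x : (Fin a → ℤ) × Fin a) :
    ∑ i, ((markedShift a ^ l) x).1 i = ∑ i, x.1 i - l ∧
      markedValue ((markedShift a ^ l) x) = markedValue x - l ∧
      weight ((markedShift a ^ l) x).1 = weight x.1 + tri (l + 1) - l * ∑ i, x.1 i := by
  have step : ∀ y : (Fin a → ℤ) × Fin a, ∑ i, (markedShift a y).1 i = ∑ i, y.1 i - 1 ∧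
      weight (markedShift a y).1 = weight y.1 + 1 - ∑ i, y.1 i :=
    fun y => ⟨sum_shift y.1, weight_shift y.1⟩
  induction l with
  | zero => simp [tri]
  | succ n ih =>
    obtain ⟨h1, h2, h3⟩ := ih
    rw [add_comm, zpow_add, zpow_one, Equiv.Perm.mul_apply, markedValue_markedShift,
      (step _).1, (step _).2, h1, h2, h3, add_comm 1 (n : ℤ), tri_add_one (n + 1)]
    exact ⟨by ring, by ring, by ring⟩
  | pred n ih =>
    obtain ⟨h1, h2, h3⟩ := ih
    set y := (markedShift a ^ (-(n : ℤ) - 1)) x with hy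
    have hx : (markedShift a ^ (-(n : ℤ))) x = markedShift a y := by
      rw [hy, ← Equiv.Perm.mul_apply, ← zpow_one_add]; congr 2; ring
    rw [hx] at h1 h2 h3
    rw [(step y).1] at h1
    rw [markedValue_markedShift] at h2
    rw [(step y).2] at h3
    have ht := tri_add_one (-(n : ℤ))
    rw [show -(n : ℤ) - 1 + 1 = -(n : ℤ) by ring]
    refine ⟨by linarith, by linarith, by linear_combination h3 + h1 + ht⟩

/-- A marked vector is uniquely a shift of a marked vector with coordinate sum zero. -/
def zeroSumShiftEquiv (a : ℕ) [NeZero a] :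
    (ZeroSum a × Fin a) × ℤ ≃ (Fin a → ℤ) × Fin a where
  toFun p := (markedShift a ^ (-p.2)) (p.1.1.1, p.1.2)
  invFun x := ((⟨((markedShift a ^ (∑ i, x.1 i)) x).1, by
    rw [(markedShift_zpow _ x).1, sub_self]⟩, ((markedShift a ^ (∑ i, x.1 i)) x).2), ∑ i, x.1 i)
  left_inv p := by
    obtain ⟨⟨⟨N, hN⟩, j⟩, l⟩ := p
    have h : ∑ i, ((markedShift a ^ (-l)) (N, j)).1 i = l := by
      rw [(markedShift_zpow (-l) (N, j)).1, hN]; ring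
    have h2 : (markedShift a ^ l) ((markedShift a ^ (-l)) (N, j)) = (N, j) := by
      rw [← Equiv.Perm.mul_apply, ← zpow_add, add_neg_cancel, zpow_zero, Equiv.Perm.one_apply]
    simp only [h, h2]
  right_inv x := by
    dsimp only
    rw [Prod.mk.eta, ← Equiv.Perm.mul_apply, ← zpow_add, neg_add_cancel, zpow_zero,
      Equiv.Perm.one_apply]

/-- As `tri (1 - l) = tri l`, the weight grows by exactly the exponent in Jacobi's series. -/
theorem zeroSumShiftEquiv_spec (p : (ZeroSum a × Fin a) × ℤ) :
    ∑ i, (zeroSumShiftEquiv a p).1 i = p.2 ∧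
      markedValue (zeroSumShiftEquiv a p) = markedValue (p.1.1.1, p.1.2) + p.2 ∧
      weight (zeroSumShiftEquiv a p).1 = weight p.1.1.1 + tri p.2 := by
  obtain ⟨h1, h2, h3⟩ := markedShift_zpow (-p.2) (p.1.1.1, p.1.2)
  simp only [p.1.1.2] at h1 h3
  have h4 := two_mul_tri (-p.2 + 1)
  have h5 := two_mul_tri p.2
  refine ⟨h1.trans (by ring), h2.trans (by ring), h3.trans ?_⟩
  rw [← mul_right_inj' (two_ne_zero (α := ℤ))]
  linear_combination h4 - h5

end Shift

/-! ### Products over residue classes modulo `a`. -/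

/-- Group the factors by the residue of their index modulo `a`. -/
theorem poch_eq_prod (x : ℂ) {q : ℂ} (hq : ‖q‖ < 1) (a : ℕ) [NeZero a] :
    poch x q = ∏ i : Fin a, poch (x * q ^ (i : ℕ)) (q ^ a) := by
  have hqa : ‖q ^ a‖ < 1 := by
    rw [norm_pow]; exact pow_lt_one₀ (norm_nonneg _) hq (NeZero.ne a)
  have h := (((Equiv.prodComm _ _).trans (Nat.divModEquiv a).symm).hasProd_iff).mpr
    (hasProd_poch x hq)
  have h2 := h.prod_fiberwise (g := fun i : Fin a => poch (x * q ^ (i : ℕ)) (q ^ a)) fun i => by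
    convert hasProd_poch (x * q ^ (i : ℕ)) hqa using 2 with n
    simp [Nat.divModEquiv, pow_add, pow_mul']
    ring
  exact h2.unique (hasProd_fintype _)

theorem theta_one {q : ℂ} : theta 1 q = 0 := by
  have : poch 1 q = 0 := tprod_of_exists_eq_zero ⟨0, by simp⟩
  rw [theta, this, zero_mul]

theorem prod_theta_pow {q : ℂ} (hq : ‖q‖ < 1) (hq0 : q ≠ 0) (m : ℕ) :
    (∏ i : Fin m, theta (q ^ ((i : ℕ) + 1)) (q ^ (m + 1))) * E (q ^ (m + 1)) ^ 2 = E q ^ 2 := by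
  set V := ∏ i : Fin m, poch (q ^ ((i : ℕ) + 1)) (q ^ (m + 1)) with hV
  have h1 : E q = V * E (q ^ (m + 1)) := by
    rw [E_eq_poch, E_eq_poch, poch_eq_prod q hq (m + 1), Fin.prod_univ_castSucc]
    simp only [hV, Fin.val_castSucc, Fin.val_last, pow_succ']
  -- The second halves of the thetas are the first halves in reverse order, by `k ↦ m + 1 - k` on
  -- exponents.
  have h2 : ∏ i : Fin m, poch ((q ^ ((i : ℕ) + 1))⁻¹ * q ^ (m + 1)) (q ^ (m + 1)) = V := by
    refine Fintype.prod_equiv Fin.revPerm _ _ fun i => ?_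
    congr 1
    rw [Fin.revPerm_apply, Fin.val_rev, inv_mul_eq_iff_eq_mul₀ (pow_ne_zero _ hq0), ← pow_add]
    congr 1
    omega
  simp only [theta, Finset.prod_mul_distrib]
  rw [h2, h1]
  ring

theorem zpow_finsetSum {ι : Type*} {x : ℂ} (hx : x ≠ 0) (s : Finset ι) (f : ι → ℤ) :
    x ^ ∑ i ∈ s, f i = ∏ i ∈ s, x ^ f i := by
  classical
  induction s using Finset.induction_on with
  | empty => simp
  | insert i s hi ih => rw [Finset.sum_insert hi, Finset.prod_insert hi, zpow_add₀ hx, ih]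

/-! ### Weights and absolute convergence. -/

section Weight

variable {a : ℕ}

/-- For `n < 0` the linear term is negative, but `i ≤ a - 1` keeps it from cancelling the quadratic
growth. -/
theorem abs_mul_sub_one_le_two_mul_weight (i : Fin a) (n : ℤ) :
    |n| * (|n| - 1) ≤ 2 * ((a : ℤ) * tri n + (i.val : ℤ) * n) := by
  have h1 := two_mul_tri n
  have h2 : (i.val : ℤ) + 1 ≤ a := by exact_mod_cast i.isLt
  have h3 : (0 : ℤ) ≤ i.val := by positivity
  have h4 : 2 * ((a : ℤ) * tri n + (i.val : ℤ) * n) = a * (n * (n - 1)) + 2 * i.val * n := by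
    linear_combination (a : ℤ) * h1
  have h5 := tri_nonneg n
  rw [h4]
  generalize (i.val : ℤ) = c at *
  generalize (a : ℤ) = b at *
  rcases le_or_gt 0 n with h | h
  · rw [abs_of_nonneg h]
    nlinarith [mul_nonneg h3 h]
  · rw [abs_of_neg h]
    have h6 : 0 ≤ (b - 1 - c) * (-n) := mul_nonneg (by linarith) (by linarith)
    have h7 : 0 ≤ (b - 1) * (n * (n + 1)) :=
      mul_nonneg (by linarith) (mul_nonneg_of_nonpos_of_nonpos (by linarith) (by linarith))
    nlinarith

theorem weight_eq_quadForm (n : ZeroSum a) : weight n.1 = quadForm a n := by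
  have h1 : 2 * weight n.1 = a * ∑ i, n.1 i ^ 2 + 2 * ∑ i : Fin a, ((i : ℕ) : ℤ) * n.1 i := by
    have h : ∀ i, 2 * ((a : ℤ) * tri (n.1 i) + (i.val : ℤ) * n.1 i) =
        a * n.1 i ^ 2 + 2 * ((i.val : ℤ) * n.1 i) - a * n.1 i := fun i => by
      linear_combination (a : ℤ) * two_mul_tri (n.1 i)
    rw [weight, Finset.mul_sum, Finset.sum_congr rfl fun i _ => h i, Finset.sum_sub_distrib,
      Finset.sum_add_distrib, ← Finset.mul_sum, ← Finset.mul_sum, ← Finset.mul_sum, n.2]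
    ring
  have h2 := quadForm_cast a n
  have h3 : (2 * weight n.1 : ℚ) =
      a * ∑ i, (n.1 i : ℚ) ^ 2 + 2 * ∑ i : Fin a, ((i : ℕ) : ℚ) * n.1 i := by exact_mod_cast h1
  have h4 : (weight n.1 : ℚ) = quadForm a n := by rw [h2]; linarith
  exact_mod_cast h4

/-- A summable bound for the terms of all the multidimensional series. -/
def bound (r Z : ℝ) (N : Fin a → ℤ) : ℝ :=
  Z ^ a * ∏ i, (r ^ ((N i).natAbs * ((N i).natAbs - 1) / 2) * (Z ^ a) ^ (N i).natAbs)

theorem summable_bound {r Z : ℝ} (h0 : 0 ≤ r) (h1 : r < 1) (hZ : 0 ≤ Z) :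
    Summable (bound (a := a) r Z) := by
  have h := (summable_norm_and_tsum_pi_prod a
    (fun (_ : Fin a) (n : ℤ) => r ^ (n.natAbs * (n.natAbs - 1) / 2) * (Z ^ a) ^ n.natAbs)
    fun _ => (summable_gaussian h0 h1 (pow_nonneg hZ a)).norm).1
  exact h.of_norm.mul_left _

/-- Uniform on the annulus `‖z‖, ‖z⁻¹‖ ≤ Z`, as continuity requires; the condition on `M` covers
both the marked values and the exceptional exponent `-a n_{a-1}`. -/
theorem norm_le_bound {q z : ℂ} {Z : ℝ} (hq : ‖q‖ < 1) (h1 : 1 ≤ Z) (hz : ‖z‖ ≤ Z)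
    (hz' : ‖z⁻¹‖ ≤ Z) (N : Fin a → ℤ) {M : ℤ} {j : Fin a} (hM : |M| ≤ a * |N j| + a) :
    ‖q ^ weight N * z ^ M‖ ≤ bound ‖q‖ Z N := by
  have hw : ‖q ^ weight N‖ ≤ ∏ i, ‖q‖ ^ ((N i).natAbs * ((N i).natAbs - 1) / 2) := by
    rw [Finset.prod_pow_eq_pow_sum, norm_zpow]
    refine zpow_le_pow_of_le_one (norm_nonneg _) hq.le ?_
    rw [weight, Nat.cast_sum]
    exact Finset.sum_le_sum fun i _ => natAbs_triangle_le (abs_mul_sub_one_le_two_mul_weight i _)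
  have hm : ‖z ^ M‖ ≤ Z ^ a * ∏ i, (Z ^ a) ^ (N i).natAbs := by
    refine (norm_zpow_le_pow_natAbs hz hz' M).trans ?_
    rw [Finset.prod_pow_eq_pow_sum, ← pow_mul, ← pow_add]
    refine pow_le_pow_right₀ h1 ?_
    have h2 : (N j).natAbs ≤ ∑ i, (N i).natAbs :=
      Finset.single_le_sum (f := fun i => (N i).natAbs) (fun _ _ => Nat.zero_le _)
        (Finset.mem_univ j)
    have h3 : M.natAbs ≤ a * (N j).natAbs + a := by
      zify; exact hM
    nlinarith
  rw [norm_mul, bound, Finset.prod_mul_distrib]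
  calc _ ≤ _ := mul_le_mul hw hm (norm_nonneg _) (Finset.prod_nonneg fun _ _ => by positivity)
    _ = _ := by ring

theorem abs_markedValue_le (x : (Fin a → ℤ) × Fin a) : |markedValue x| ≤ a * |x.1 x.2| + a := by
  have h1 : ((x.2.val : ℕ) : ℤ) + 1 ≤ a := by exact_mod_cast x.2.isLt
  calc |markedValue x| ≤ |(a : ℤ) * x.1 x.2| + |(x.2.val : ℤ)| := abs_add_le _ _
    _ = a * |x.1 x.2| + x.2.val := by rw [abs_mul, Nat.abs_cast, Nat.abs_cast]
    _ ≤ _ := by linarith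

theorem exists_norm_le_and_norm_inv_le (z : ℂ) : ∃ Z : ℝ, 1 ≤ Z ∧ ‖z‖ ≤ Z ∧ ‖z⁻¹‖ ≤ Z :=
  ⟨max 1 (max ‖z‖ ‖z⁻¹‖), le_max_left _ _, (le_max_left _ _).trans (le_max_right _ _),
    (le_max_right _ _).trans (le_max_right _ _)⟩

theorem summable_norm_marked {q : ℂ} (hq : ‖q‖ < 1) (z : ℂ) :
    Summable fun x : (Fin a → ℤ) × Fin a => ‖q ^ weight x.1 * z ^ markedValue x‖ := by
  obtain ⟨Z, h1, h2, h3⟩ := exists_norm_le_and_norm_inv_le z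
  refine Summable.of_nonneg_of_le (fun _ => norm_nonneg _)
    (fun x => norm_le_bound hq h1 h2 h3 x.1 (abs_markedValue_le x)) ?_
  have h := (summable_bound (a := a) (norm_nonneg q) hq (zero_le_one.trans h1)).norm.mul_norm
    (hasSum_fintype fun _ : Fin a => ‖(1 : ℝ)‖).summable
  simpa using h.of_norm

end Weight

theorem tsum_prod_fintype {β ι : Type*} [Fintype ι] {f : β × ι → ℂ} (hf : Summable f) :
    ∑' x, f x = ∑ j, ∑' b, f (b, j) := by
  rw [← (Equiv.prodComm ι β).tsum_eq f]
  exact ((Equiv.prodComm ι β).summable_iff.mpr hf).tsum_prod.trans (tsum_fintype _)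

/-! ### Multiplication by Jacobi's series. -/

section Series

variable {a : ℕ} [NeZero a]

/-- Summing over all marked vectors factors the series into one-dimensional theta series. -/
theorem tsum_marked {q z : ℂ} (hq : ‖q‖ < 1) (hq0 : q ≠ 0) (hz : z ≠ 0) :
    ∑' x : (Fin a → ℤ) × Fin a, (-1 : ℂ) ^ (∑ i, x.1 i) * (q ^ weight x.1 * z ^ markedValue x) =
      ∑ j : Fin a, z ^ (j : ℕ) * ∏ i : Fin a, ∑' k : ℤ,
        thetaTerm (q ^ a) (q ^ (i : ℕ) * if i = j then z ^ a else 1) k := by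
  have hqa : ‖q ^ a‖ < 1 := by
    rw [norm_pow]; exact pow_lt_one₀ (norm_nonneg _) hq (NeZero.ne a)
  have hsum : Summable fun x : (Fin a → ℤ) × Fin a =>
      (-1 : ℂ) ^ (∑ i, x.1 i) * (q ^ weight x.1 * z ^ markedValue x) := by
    refine ((summable_norm_marked hq z).congr fun x => ?_).of_norm
    rw [norm_mul ((-1 : ℂ) ^ _), norm_zpow, norm_neg, norm_one, one_zpow, one_mul]
  have hterm : ∀ (j : Fin a) (N : Fin a → ℤ),
      (-1 : ℂ) ^ (∑ i, N i) * (q ^ weight N * z ^ markedValue (N, j)) =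
        z ^ (j : ℕ) * ∏ i : Fin a, thetaTerm (q ^ a) (q ^ (i : ℕ) * if i = j then z ^ a else 1) (N i) := by
    intro j N
    have hp : ∀ i : Fin a, thetaTerm (q ^ a) (q ^ (i : ℕ) * if i = j then z ^ a else 1) (N i) =
        (-1) ^ N i * (q ^ ((a : ℤ) * tri (N i) + (i.val : ℤ) * N i) *
          if i = j then z ^ ((a : ℤ) * N i) else 1) := by
      intro i
      rw [thetaTerm, mul_zpow, zpow_add₀ hq0, zpow_mul, zpow_mul, zpow_natCast, zpow_natCast]
      split_ifs
      · rw [zpow_mul, zpow_natCast]; ring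
      · rw [one_zpow]; ring
    simp only [hp]
    rw [Finset.prod_mul_distrib, Finset.prod_mul_distrib, Finset.prod_ite_eq' Finset.univ j,
      if_pos (Finset.mem_univ j), ← zpow_finsetSum hq0,
      ← zpow_finsetSum (by norm_num : (-1 : ℂ) ≠ 0)]
    simp only [markedValue]
    rw [zpow_add₀ hz, zpow_natCast, weight]
    ring
  rw [tsum_prod_fintype hsum]
  refine Finset.sum_congr rfl fun j _ => ?_
  simp only [hterm]
  rw [tsum_mul_left, (summable_norm_and_tsum_pi_prod a _ fun i => summable_norm_thetaTerm hqa _).2]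

theorem tsum_zeroSum_mul_tsum_thetaTerm {q z : ℂ} (hq : ‖q‖ < 1) (hq0 : q ≠ 0) (hz : z ≠ 0) :
    (∑' p : ZeroSum a × Fin a, q ^ weight p.1.1 * z ^ markedValue (p.1.1, p.2)) *
        ∑' l, thetaTerm q z l =
      ∑' x : (Fin a → ℤ) × Fin a, (-1 : ℂ) ^ (∑ i, x.1 i) * (q ^ weight x.1 * z ^ markedValue x) := by
  have hinj : Function.Injective fun p : ZeroSum a × Fin a => (p.1.1, p.2) := by
    rintro ⟨p, j⟩ ⟨p', j'⟩ h
    simp only [Prod.mk.injEq] at h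
    exact Prod.ext (Subtype.ext h.1) h.2
  rw [tsum_mul_tsum_of_summable_norm ((summable_norm_marked hq z).comp_injective hinj)
    (summable_norm_thetaTerm hq z), ← (zeroSumShiftEquiv a).tsum_eq]
  refine tsum_congr fun p => ?_
  obtain ⟨h1, h2, h3⟩ := zeroSumShiftEquiv_spec p
  rw [h1, h2, h3, zpow_add₀ hq0, zpow_add₀ hz, thetaTerm]
  ring

end Series

/-! ### Reflection, and the series `C`. -/

/-- The lattice symmetry `n_i ↦ -n_{a-1-i}`. -/
def reflect (a : ℕ) : ZeroSum a ≃ ZeroSum a :=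
  Function.Involutive.toPerm
    (fun n => ⟨fun i => -n.1 i.rev, by
      rw [Finset.sum_neg_distrib, neg_eq_zero]
      exact (Fintype.sum_equiv Fin.revPerm _ _ fun _ => rfl).trans n.2⟩)
    (fun n => by ext i; simp)

/-- The linear part changes by `(a - 1) ∑ n_i`, which is zero. -/
theorem quadForm_reflect {a : ℕ} (n : ZeroSum a) : quadForm a (reflect a n) = quadForm a n := by
  have h : ∀ i : Fin a, ((i : ℕ) : ℤ) * (reflect a n).1 i =
      ((i.rev : ℕ) : ℤ) * n.1 i.rev - (a - 1) * n.1 i.rev := by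
    intro i
    have h1 : ((i.rev : ℕ) : ℤ) = a - 1 - (i : ℕ) := by
      rw [Fin.val_rev]; have := i.isLt; omega
    have h2 : (reflect a n).1 i = -n.1 i.rev := rfl
    rw [h1, h2]; ring
  have e1 : ∀ g : Fin a → ℤ, ∑ i : Fin a, g i.rev = ∑ i, g i :=
    fun g => Fintype.sum_equiv Fin.revPerm _ _ fun _ => rfl
  have h2 : ∑ i, (reflect a n).1 i ^ 2 = ∑ i, n.1 i ^ 2 := by
    rw [← e1]
    exact Finset.sum_congr rfl fun i _ => by
      have h2 : (reflect a n).1 i.rev = -n.1 i.rev.rev := rfl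
      rw [h2, Fin.rev_rev, neg_sq]
  unfold quadForm
  rw [h2, Finset.sum_congr rfl fun i _ => h i, Finset.sum_sub_distrib, ← Finset.mul_sum, e1 n.1,
    n.2, e1 fun i => ((i : ℕ) : ℤ) * n.1 i, mul_zero, sub_zero]

section Main

variable {a : ℕ}

theorem norm_cTerm_le (ha : 2 ≤ a) {q z : ℂ} {Z : ℝ} (hq : ‖q‖ < 1) (h1 : 1 ≤ Z) (hz : ‖z‖ ≤ Z)
    (hz' : ‖z⁻¹‖ ≤ Z) (n : ZeroSum a) :
    ‖cTerm a ha z q n‖ ≤ (a + 1) * bound ‖q‖ Z n.1 := by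
  have hB : 0 ≤ bound ‖q‖ Z n.1 :=
    mul_nonneg (by positivity) (Finset.prod_nonneg fun _ _ => by positivity)
  rw [cTerm, zFactor, mul_add, Finset.mul_sum, ← weight_eq_quadForm, add_mul, one_mul]
  refine (norm_add_le _ _).trans (add_le_add ?_ ?_)
  · refine (norm_sum_le _ _).trans ?_
    refine (Finset.sum_le_card_nsmul _ _ _ fun j _ =>
      norm_le_bound hq h1 hz hz' n.1 (abs_markedValue_le (n.1, j))).trans ?_
    rw [nsmul_eq_mul]
    refine mul_le_mul_of_nonneg_right ?_ hB
    exact_mod_cast (Finset.card_filter_le _ _).trans_eq (Finset.card_fin a)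
  · refine norm_le_bound hq h1 hz hz' n.1 (j := ⟨a - 1, by omega⟩) ?_
    rw [abs_neg, abs_mul, Nat.abs_cast]
    simp

theorem summable_cTerm_bound {q : ℂ} (hq : ‖q‖ < 1) {Z : ℝ} (hZ : 1 ≤ Z) :
    Summable fun n : ZeroSum a => ((a : ℝ) + 1) * bound ‖q‖ Z n.1 :=
  ((summable_bound (norm_nonneg q) hq (zero_le_one.trans hZ)).comp_injective
    Subtype.val_injective).mul_left _

theorem summable_cTerm (ha : 2 ≤ a) {q : ℂ} (hq : ‖q‖ < 1) (z : ℂ) : Summable (cTerm a ha z q) := by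
  obtain ⟨Z, h1, h2, h3⟩ := exists_norm_le_and_norm_inv_le z
  exact (summable_cTerm_bound hq h1).of_norm_bounded fun n => norm_cTerm_le ha hq h1 h2 h3 n

theorem continuousAt_C (ha : 2 ≤ a) {q z : ℂ} (hq : ‖q‖ < 1) (hz : z ≠ 0) :
    ContinuousAt (fun w => C a ha w q) z := by
  obtain ⟨Z, h1, h2, h3⟩ := exists_norm_le_and_norm_inv_le z
  have hs : {w : ℂ | w ≠ 0 ∧ ‖w‖ ≤ Z + 1 ∧ ‖w⁻¹‖ ≤ Z + 1} ∈ 𝓝 z := by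
    filter_upwards [isOpen_ne.mem_nhds hz,
      continuous_norm.continuousAt.eventually (gt_mem_nhds (show ‖z‖ < Z + 1 by linarith)),
      (continuousAt_inv₀ hz).norm.eventually (gt_mem_nhds (show ‖z⁻¹‖ < Z + 1 by linarith))]
      with w h4 h5 h6
    exact ⟨h4, h5.le, h6.le⟩
  refine (continuousOn_tsum (fun n => ?_) (summable_cTerm_bound hq (Z := Z + 1) (by linarith))
    fun n w hw => norm_cTerm_le ha hq (by linarith) hw.2.1 hw.2.2 n).continuousAt hs
  unfold cTerm zFactor
  refine continuousOn_const.mul (ContinuousOn.add (continuousOn_finsetSum _ fun j _ => ?_) ?_) <;>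
    exact continuousOn_id.zpow₀ _ fun w hw => Or.inl hw.1

theorem filter_one_le_eq_erase_zero [NeZero a] :
    Finset.univ.filter (fun j : Fin a => 1 ≤ (j : ℕ)) = Finset.univ.erase 0 := by
  ext j
  rw [Finset.mem_filter, Finset.mem_erase, and_comm]
  exact and_congr_left fun _ => Nat.one_le_iff_ne_zero.trans Fin.val_ne_zero_iff

/-- The series `C` as a sum over marked vectors of coordinate sum zero. -/
theorem C_eq_tsum_marked [NeZero a] (ha : 2 ≤ a) {q : ℂ} (hq : ‖q‖ < 1) (z : ℂ) :
    C a ha z q = ∑' p : ZeroSum a × Fin a, q ^ weight p.1.1 * z ^ markedValue (p.1.1, p.2) := by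
  have hinj : Function.Injective fun p : ZeroSum a × Fin a => (p.1.1, p.2) := by
    rintro ⟨p, j⟩ ⟨p', j'⟩ h
    simp only [Prod.mk.injEq] at h
    exact Prod.ext (Subtype.ext h.1) h.2
  have hs : Summable fun p : ZeroSum a × Fin a =>
      q ^ weight p.1.1 * z ^ markedValue (p.1.1, p.2) :=
    ((summable_norm_marked hq z).comp_injective hinj).of_norm
  have hj : ∀ j : Fin a, Summable fun n : ZeroSum a => q ^ weight n.1 * z ^ markedValue (n.1, j) :=
    fun j => by
      have h := hs.comp_injective (i := fun n : ZeroSum a => (n, j)) (Prod.mk_left_injective j)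
      simpa only [Function.comp_def] using h
  have hr : ∀ n : ZeroSum a, q ^ weight (reflect a n).1 * z ^ markedValue ((reflect a n).1, 0) =
      q ^ quadForm a n * z ^ (-((a : ℤ) * n.1 ⟨a - 1, by omega⟩)) := by
    intro n
    have h0 : (reflect a n).1 0 = -n.1 ⟨a - 1, by omega⟩ := by
      change -n.1 (Fin.rev 0) = _
      congr 2
    rw [weight_eq_quadForm, quadForm_reflect, markedValue]
    simp [h0]
  have hr0 : Summable fun n : ZeroSum a =>
      q ^ quadForm a n * z ^ (-((a : ℤ) * n.1 ⟨a - 1, by omega⟩)) := by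
    simp only [← hr]
    exact (reflect a).summable_iff.mpr (hj 0)
  rw [tsum_prod_fintype hs, ← Finset.sum_erase_add _ _ (Finset.mem_univ 0)]
  -- Only the part marked at `0` is reflected; it becomes the exceptional term of `zFactor`.
  rw [← (reflect a).tsum_eq fun n => q ^ weight n.1 * z ^ markedValue (n.1, 0)]
  simp only [hr]
  rw [← Summable.tsum_finsetSum fun j _ => hj j,
    ← Summable.tsum_add (summable_sum fun j _ => hj j) hr0, C]
  refine tsum_congr fun n => ?_
  rw [cTerm, zFactor, filter_one_le_eq_erase_zero, mul_add, Finset.mul_sum, weight_eq_quadForm]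
  simp only [markedValue]

theorem C_mul_tsum_thetaTerm [NeZero a] (ha : 2 ≤ a) {q z : ℂ} (hq : ‖q‖ < 1) (hq0 : q ≠ 0)
    (hz : z ≠ 0) :
    C a ha z q * (E q * theta z q) =
      ∏ i : Fin a, (E (q ^ a) * theta (if i = 0 then z ^ a else q ^ (i : ℕ)) (q ^ a)) := by
  have hqa : ‖q ^ a‖ < 1 := by
    rw [norm_pow]; exact pow_lt_one₀ (norm_nonneg _) hq (NeZero.ne a)
  rw [← tsum_thetaTerm hq hq0 hz, C_eq_tsum_marked ha hq z,
    tsum_zeroSum_mul_tsum_thetaTerm hq hq0 hz, tsum_marked hq hq0 hz]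
  have ht : ∀ i j : Fin a, ∑' k : ℤ, thetaTerm (q ^ a) (q ^ (i : ℕ) * if i = j then z ^ a else 1) k =
      E (q ^ a) * theta (q ^ (i : ℕ) * if i = j then z ^ a else 1) (q ^ a) := fun i j =>
    tsum_thetaTerm hqa (pow_ne_zero _ hq0)
      (mul_ne_zero (pow_ne_zero _ hq0) (by split_ifs <;> simp [hz]))
  simp only [ht]
  rw [Finset.sum_eq_single 0]
  · simp only [Fin.val_zero, pow_zero, one_mul]
    refine Finset.prod_congr rfl fun i _ => ?_
    split_ifs with h
    · subst h; simp
    · rw [mul_one]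
  · intro j _ hj
    -- When `j ≠ 0`, the factor at `i = 0` has theta argument `q ^ 0 = 1`.
    rw [Finset.prod_eq_zero (Finset.mem_univ 0), mul_zero]
    rw [if_neg hj.symm, Fin.val_zero, pow_zero, mul_one, theta_one, mul_zero]
  · simp

theorem poch_zero_right (x : ℂ) : poch x 0 = 1 - x := by
  rw [poch, tprod_eq_mulSingle 0 fun n hn => by simp [hn]]
  simp

/-- Makes the exponent positive off the zero vector, so that only that vector contributes at `q =
0`. Adding `n_i` to each term is harmless because the coordinates sum to zero. -/
theorem sum_sq_le_two_mul_quadForm (n : ZeroSum a) : ∑ i, n.1 i ^ 2 ≤ 2 * quadForm a n := by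
  have h : ∀ i : Fin a,
      n.1 i ^ 2 ≤ 2 * ((a : ℤ) * tri (n.1 i) + (i.val : ℤ) * n.1 i) + n.1 i := by
    intro i
    have h1 := two_mul_tri (n.1 i)
    have h2 : (i.val : ℤ) + 1 ≤ a := by exact_mod_cast i.isLt
    have h3 : (0 : ℤ) ≤ i.val := by positivity
    have h4 : 2 * ((a : ℤ) * tri (n.1 i) + (i.val : ℤ) * n.1 i) =
        a * (n.1 i * (n.1 i - 1)) + 2 * i.val * n.1 i := by
      linear_combination (a : ℤ) * h1
    rw [h4]
    generalize (i.val : ℤ) = c at *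
    generalize (a : ℤ) = b at *
    generalize n.1 i = m at *
    have h5 : 0 ≤ (b - 1) * (m * (m - 1)) := mul_nonneg (by linarith) (h1 ▸ by
      linarith [tri_nonneg m])
    have h6 : 0 ≤ (b - 1) * (m * (m + 1)) := mul_nonneg (by linarith) (by
      have h7 := two_mul_tri (m + 1)
      linarith [tri_nonneg (m + 1)])
    rcases le_or_gt 0 m with hm | hm
    · nlinarith [mul_nonneg h3 hm]
    · nlinarith [mul_nonneg (sub_nonneg.mpr h2) (neg_nonneg.mpr hm.le)]
  calc _ ≤ _ := Finset.sum_le_sum fun i _ => h i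
    _ = _ := by
      rw [Finset.sum_add_distrib, n.2, ← Finset.mul_sum, ← weight_eq_quadForm, weight, add_zero]

theorem C_zero (ha : 2 ≤ a) (z : ℂ) : C a ha z 0 = ∑ j ∈ Finset.range a, z ^ j := by
  have hpos : ∀ n : ZeroSum a, n ≠ ⟨0, by simp⟩ → cTerm a ha z 0 n = 0 := by
    intro n hn
    obtain ⟨i, hi⟩ : ∃ i, n.1 i ≠ 0 := by
      by_contra! h
      exact hn (Subtype.ext (funext h))
    have h1 := sum_sq_le_two_mul_quadForm n
    have h2 : 0 < ∑ i, n.1 i ^ 2 :=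
      Finset.sum_pos' (fun _ _ => sq_nonneg _) ⟨i, Finset.mem_univ i, by positivity⟩
    rw [cTerm, zero_zpow _ (by omega), zero_mul]
  obtain ⟨m, rfl⟩ : ∃ m, a = m + 1 := ⟨a - 1, by omega⟩
  rw [C, tsum_eq_single _ hpos, Finset.sum_range]
  have h : ∑ j : Fin (m + 1), z ^ (j : ℕ) =
      ∑ j ∈ Finset.univ.erase (0 : Fin (m + 1)), z ^ (j : ℕ) + 1 := by
    rw [← Finset.sum_erase_add _ _ (Finset.mem_univ 0), Fin.val_zero, pow_zero]
  rw [cTerm, zFactor, filter_one_le_eq_erase_zero, h]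
  simp [quadForm]

/-- The product formula with denominators cleared. -/
theorem C_mul_theta (ha : 2 ≤ a) {q z : ℂ} (hq : ‖q‖ < 1) (hz : z ≠ 0) :
    C a ha z q * theta z q = E q * E (q ^ a) ^ (a - 2) * theta (z ^ a) (q ^ a) := by
  obtain ⟨m, rfl⟩ : ∃ m, a = m + 2 := ⟨a - 2, by omega⟩
  -- The shift argument needs integer powers of `q` to add, so `q = 0` is separate; there the claim
  -- is a finite geometric sum.
  rcases eq_or_ne q 0 with rfl | hq0
  · rw [C_zero, zero_pow (by omega)]
    simp only [theta, E_eq_poch, poch_zero_right, mul_zero, sub_zero, mul_one, one_pow, one_mul]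
    rw [mul_comm]
    exact mul_neg_geom_sum z (m + 2)
  · have h := C_mul_tsum_thetaTerm ha hq hq0 hz
    have hV := prod_theta_pow hq hq0 (m + 1)
    have hE : E q ≠ 0 := by
      rw [E_eq_poch]; exact poch_ne_zero_of_norm_lt_one hq hq
    rw [Fin.prod_univ_succ] at h
    simp only [Fin.succ_ne_zero, if_true, if_false, Fin.val_succ, Finset.prod_mul_distrib,
      Finset.prod_const, Finset.card_univ, Fintype.card_fin] at h
    apply mul_left_cancel₀ hE
    simp only [Nat.add_sub_cancel]
    linear_combination h + E (q ^ (m + 2)) ^ m * theta (z ^ (m + 2)) (q ^ (m + 2)) * hV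

/-! ### Division by theta and removal of singularities. -/

theorem hasProd_theta (z : ℂ) {q : ℂ} (hq : ‖q‖ < 1) :
    HasProd (fun n : ℕ => (1 - z * q ^ n) * (1 - z⁻¹ * q ^ (n + 1))) (theta z q) := by
  have h : (fun n : ℕ => (1 - z * q ^ n) * (1 - z⁻¹ * q ^ (n + 1))) =
      fun n : ℕ => (1 - z * q ^ n) * (1 - z⁻¹ * q * q ^ n) := by
    funext n; ring
  rw [h]
  exact (hasProd_poch z hq).mul (hasProd_poch (z⁻¹ * q) hq)

theorem theta_ne_zero {z q : ℂ} (hq : ‖q‖ < 1)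
    (h : ∀ n : ℕ, 1 - z * q ^ n ≠ 0 ∧ 1 - z⁻¹ * q ^ (n + 1) ≠ 0) : theta z q ≠ 0 := by
  refine mul_ne_zero (poch_ne_zero hq fun n => (h n).1) (poch_ne_zero hq fun n => ?_)
  have := (h n).2
  rwa [pow_succ', ← mul_assoc] at this

theorem hasProd_rFactor {z q : ℂ} (ha : a ≠ 0) (hq : ‖q‖ < 1) (h : theta z q ≠ 0) :
    HasProd (rFactor a z q) (theta (z ^ a) (q ^ a) / theta z q) := by
  have hqa : ‖q ^ a‖ < 1 := by
    rw [norm_pow]; exact pow_lt_one₀ (norm_nonneg _) hq ha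
  refine ((hasProd_theta (z ^ a) hqa).div₀ (hasProd_theta z hq) h).congr_fun fun n => ?_
  rw [rFactor, pow_mul, pow_mul]

theorem C_eq_R (ha : 2 ≤ a) {q z : ℂ} (hq : ‖q‖ < 1) (hz : z ≠ 0) (h : theta z q ≠ 0) :
    C a ha z q = R a z q := by
  rw [R, (hasProd_rFactor (by omega) hq h).tprod_eq, ← mul_div_assoc, eq_div_iff h,
    C_mul_theta ha hq hz]

/-- Near `z`, `‖w * q ^ n‖ < 1` for all large `n`, uniformly in `w`; each of the finitely many
remaining factors has at most one zero. -/
theorem eventually_one_sub_mul_pow_ne_zero (z : ℂ) {q : ℂ} (hq : ‖q‖ < 1) :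
    ∀ᶠ w in 𝓝[≠] z, ∀ n : ℕ, 1 - w * q ^ n ≠ 0 := by
  have hlim : Tendsto (fun n : ℕ => (‖z‖ + 1) * ‖q‖ ^ n) atTop (𝓝 ((‖z‖ + 1) * 0)) :=
    (tendsto_pow_atTop_nhds_zero_of_lt_one (norm_nonneg q) hq).const_mul _
  rw [mul_zero] at hlim
  obtain ⟨K, hK⟩ := eventually_atTop.mp (hlim.eventually (gt_mem_nhds one_pos))
  have h1 : ∀ᶠ w in 𝓝[≠] z, ‖w‖ < ‖z‖ + 1 := nhdsWithin_le_nhds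
    (continuous_norm.continuousAt.eventually (gt_mem_nhds (lt_add_one ‖z‖)))
  have h2 : ∀ᶠ w in 𝓝[≠] z, ∀ n ∈ Finset.range K, 1 - w * q ^ n ≠ 0 := by
    rw [Filter.eventually_all_finset]
    intro n _
    by_cases hz : 1 - z * q ^ n = 0
    · filter_upwards [self_mem_nhdsWithin] with w hw h
      have hq0 : q ^ n ≠ 0 := by
        rintro h0
        simp [h0] at hz
      exact hw (mul_right_cancel₀ hq0 (by linear_combination hz - h))
    · have hc : Continuous fun w : ℂ => 1 - w * q ^ n := by fun_prop
      exact nhdsWithin_le_nhds (hc.continuousAt.eventually_ne hz)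
  filter_upwards [h1, h2] with w hw1 hw2 n h
  rcases lt_or_ge n K with hn | hn
  · exact hw2 n (Finset.mem_range.mpr hn) h
  · have h3 := hK n hn
    have h4 : ‖w‖ * ‖q‖ ^ n = 1 := by
      rw [← norm_pow, ← norm_mul, ← sub_eq_zero.mp h, norm_one]
    have h5 : ‖w‖ * ‖q‖ ^ n ≤ (‖z‖ + 1) * ‖q‖ ^ n := by gcongr
    linarith

theorem eventually_theta_ne_zero {z q : ℂ} (hq : ‖q‖ < 1) (hz : z ≠ 0) :
    ∀ᶠ w in 𝓝[≠] z, theta w q ≠ 0 := by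
  have hinv : Tendsto (fun w : ℂ => w⁻¹) (𝓝[≠] z) (𝓝[≠] z⁻¹) :=
    tendsto_nhdsWithin_iff.mpr ⟨(continuousAt_inv₀ hz).mono_left nhdsWithin_le_nhds, by
      filter_upwards [self_mem_nhdsWithin] with w hw h
      exact hw (inv_injective h)⟩
  filter_upwards [eventually_one_sub_mul_pow_ne_zero z hq,
    hinv.eventually (eventually_one_sub_mul_pow_ne_zero z⁻¹ hq)] with w h1 h2
  exact theta_ne_zero hq fun n => ⟨h1 n, h2 (n + 1)⟩

end Main

end ThetaIdentity

end

theorem theorem1 (a : ℕ) (ha : 2 ≤ a) (z q : ℂ) (hz : z ≠ 0) (hq : ‖q‖ < 1) :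
    -- the series and the products converge
    Summable (ThetaIdentity.cTerm a ha z q) ∧
    Multipliable (fun n : ℕ => 1 - q ^ (n + 1)) ∧
    Multipliable (fun n : ℕ => 1 - (q ^ a) ^ (n + 1)) ∧
    -- the identity wherever no denominator vanishes
    ((∀ n : ℕ, 1 - z * q ^ n ≠ 0 ∧ 1 - z⁻¹ * q ^ (n + 1) ≠ 0) →
      Multipliable (ThetaIdentity.rFactor a z q) ∧
      ThetaIdentity.C a ha z q = ThetaIdentity.R a z q) ∧
    -- at every point, the identity after removal of the removable singularities
    Tendsto (fun w : ℂ => ThetaIdentity.R a w q) (𝓝[≠] z) (𝓝 (ThetaIdentity.C a ha z q)) := by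
  have hqa : ‖q ^ a‖ < 1 := by
    rw [norm_pow]; exact pow_lt_one₀ (norm_nonneg _) hq (by omega)
  refine ⟨ThetaIdentity.summable_cTerm ha hq z, ?_, ?_, fun h => ?_, ?_⟩
  · simpa only [pow_succ'] using ThetaIdentity.multipliable_poch q hq
  · simpa only [pow_succ'] using ThetaIdentity.multipliable_poch (q ^ a) hqa
  · have h0 := ThetaIdentity.theta_ne_zero hq h
    exact ⟨(ThetaIdentity.hasProd_rFactor (by omega) hq h0).multipliable,
      ThetaIdentity.C_eq_R ha hq hz h0⟩
  · refine ((ThetaIdentity.continuousAt_C ha hq hz).mono_left nhdsWithin_le_nhds).congr' ?_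
    filter_upwards [ThetaIdentity.eventually_theta_ne_zero hq hz,
      nhdsWithin_le_nhds (isOpen_ne.mem_nhds hz)] with w hw hw0
    exact ThetaIdentity.C_eq_R ha hq hw0 hw
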